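/- Let $\mathcal H$ be a finite-dimensional complex Hilbert space of dimension at least $1$ with a fixed orthonormal reference basis $\{|i\rangle\}$, let $\mathcal D(\mathcal H)$ be its set of density matrices, let $\mathcal I\subset\mathcal D(\mathcal H)$ be the set of incoherent states (the density matrices that are diagonal in the reference basis), and let $\Delta(\rho)=\sum_i\langle i|\rho|i\rangle\,|i\rangle\langle i|$. With $S(\rho)=-\operatorname{tr}(\rho\log_2\rho)$ and $S(\rho\|\sigma)=\operatorname{tr}[\rho(\log_2\rho-\log_2\sigma)]$ (equal to $+\infty$ unless $\operatorname{supp}\rho\subseteq\operatorname{supp}\sigma$), define the relative entropy of coherence and the coherence of formation by $$C_r(\rho)=\min_{\sigma\in\mathcal I}S(\rho\|\sigma),\qquad C_f(\rho)=\min_{\{p_i,|\psi_i\rangle\}}\sum_i p_i\,S\bigl(\Delta(|\psi_i\rangle\langle\psi_i|)\bigr),$$ where the second minimum is over all finite pure state decompositions $\rho=\sum_ip_i|\psi_i\rangle\langle\psi_i|$. A quantum channel is a completely positive trace-preserving linear map. For $C\in\{C_r,C_f\}$ the coherence increasing power of a channel $\Lambda$ with input space $\mathcal H$ is $$P_C(\Lambda)=\sup_{\rho\in\mathcal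 D(\mathcal H)}\bigl[C(\Lambda(\rho))-C(\rho)\bigr].$$ **Theorem.** Let $\Lambda$ and $\mathcal E$ be quantum channels between such finite-dimensional spaces, the input and output space of a channel being allowed to differ, and let the tensor product spaces carry the product reference bases. Then, for $C=C_r$ and for $C=C_f$, the suprema $P_C(\Lambda)$, $P_C(\mathcal E)$ and $P_C(\Lambda\otimes\mathcal E)$ are finite and $$P_C(\Lambda\otimes\mathcal E)\ \ge\ P_C(\Lambda)+P_C(\mathcal E).$$ -/

import Mathlib

namespace Coherence

open scoped Kronecker ComplexOrder

noncomputable section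

/-- A density matrix on the Hilbert space with reference basis indexed by `n`. -/
def IsState {n : Type*} [Fintype n] (ρ : Matrix n n ℂ) : Prop :=
  ρ.PosSemidef ∧ ρ.trace = 1

/-- An incoherent state: a density matrix that is diagonal in the reference basis. -/
def IsIncoherent {n : Type*} [Fintype n] (ρ : Matrix n n ℂ) : Prop :=
  IsState ρ ∧ ρ.IsDiag

/-- The decohering operation `Δ`, which erases the off-diagonal entries. -/
def dephase {n : Type*} [DecidableEq n] (ρ : Matrix n n ℂ) : Matrix n n ℂ :=
  Matrix.diagonal ρ.diag

/-- The rank-one operator `|ψ⟩⟨ψ|`. -/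
def pureState {n : Type*} (ψ : n → ℂ) : Matrix n n ℂ :=
  Matrix.vecMulVec ψ (star ψ)

/-- The base-2 logarithm of a positive semidefinite matrix, through the continuous functional
calculus. On the kernel it is `0` (since `Real.logb 2 0 = 0`), so `ρ * log2 ρ` realizes the
convention `0 log 0 = 0`. -/
def log2 {n : Type*} [Fintype n] [DecidableEq n] (ρ : Matrix n n ℂ) : Matrix n n ℂ :=
  cfc (Real.logb 2) ρ

/-- The von Neumann entropy `S(ρ) = -tr(ρ log₂ ρ)`. -/
def entropy {n : Type*} [Fintype n] [DecidableEq n] (ρ : Matrix n n ℂ) : ℝ :=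
  -(ρ * log2 ρ).trace.re

open scoped Classical in
/-- The quantum relative entropy `S(ρ‖σ) = tr(ρ (log₂ ρ - log₂ σ))`, which is `+∞` unless the
support of `ρ` is contained in that of `σ`, i.e. unless `ker σ ⊆ ker ρ`. -/
def relEntropy {n : Type*} [Fintype n] [DecidableEq n] (ρ σ : Matrix n n ℂ) : EReal :=
  if ∀ v : n → ℂ, σ.mulVec v = 0 → ρ.mulVec v = 0 then
    (((ρ * (log2 ρ - log2 σ)).trace.re : ℝ) : EReal)
  else ⊤

/-- The relative entropy of coherence: the minimum of `S(ρ‖σ)` over all incoherent states `σ`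
(the infimum of the finite values of `S(ρ‖σ)`). -/
def relEntropyCoherence {n : Type*} [Fintype n] [DecidableEq n] (ρ : Matrix n n ℂ) : ℝ :=
  sInf {r : ℝ | ∃ σ : Matrix n n ℂ, IsIncoherent σ ∧ relEntropy ρ σ = (r : EReal)}

/-- `(p, ψ)` is a (finite) pure state decomposition of `ρ`. -/
structure IsPureDecomposition {n : Type*} [Fintype n] (ρ : Matrix n n ℂ) {k : ℕ}
    (p : Fin k → ℝ) (ψ : Fin k → n → ℂ) : Prop where
  nonneg : ∀ i, 0 ≤ p i
  sum_eq_one : ∑ i, p i = 1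
  unit : ∀ i, ∑ x, ‖ψ i x‖ ^ 2 = 1
  eq_sum : ρ = ∑ i, (p i : ℂ) • pureState (ψ i)

/-- The coherence of formation: the minimum of `∑ᵢ pᵢ S(Δ(ψᵢ))` over all pure state
decompositions of `ρ`. -/
def coherenceOfFormation {n : Type*} [Fintype n] [DecidableEq n] (ρ : Matrix n n ℂ) : ℝ :=
  sInf {r : ℝ | ∃ (k : ℕ) (p : Fin k → ℝ) (ψ : Fin k → n → ℂ), IsPureDecomposition ρ p ψ ∧
    r = ∑ i, p i * entropy (dephase (pureState (ψ i)))}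

/-- The two coherence measures. -/
inductive CoherenceMeasure where
  | relEntropy
  | formation

/-- The value of a coherence measure on a density matrix. -/
def CoherenceMeasure.eval (C : CoherenceMeasure) {n : Type*} [Fintype n] [DecidableEq n]
    (ρ : Matrix n n ℂ) : ℝ :=
  match C with
  | .relEntropy => relEntropyCoherence ρ
  | .formation => coherenceOfFormation ρ

/-- The map `id ⊗ Λ`, i.e. `Λ` applied to each block of a block matrix. -/
def idTensor (k : Type*) {m n : Type*} (Λ : Matrix m m ℂ →ₗ[ℂ] Matrix n n ℂ) :
    Matrix (k × m) (k × m) ℂ →ₗ[ℂ] Matrix (k × n) (k × n) ℂ where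
  toFun X := Matrix.of fun a b => Λ (Matrix.of fun i j => X (a.1, i) (b.1, j)) a.2 b.2
  map_add' X Y := by
    ext a b
    exact congrFun (congrFun (Λ.map_add (Matrix.of fun i j => X (a.1, i) (b.1, j))
      (Matrix.of fun i j => Y (a.1, i) (b.1, j))) a.2) b.2
  map_smul' c X := by
    ext a b
    exact congrFun (congrFun (Λ.map_smul c (Matrix.of fun i j => X (a.1, i) (b.1, j))) a.2) b.2

/-- The map `Λ ⊗ id`. -/
def tensorId {m n : Type*} (Λ : Matrix m m ℂ →ₗ[ℂ] Matrix n n ℂ) (k : Type*) :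
    Matrix (m × k) (m × k) ℂ →ₗ[ℂ] Matrix (n × k) (n × k) ℂ where
  toFun X := Matrix.of fun a b => Λ (Matrix.of fun i j => X (i, a.2) (j, b.2)) a.1 b.1
  map_add' X Y := by
    ext a b
    exact congrFun (congrFun (Λ.map_add (Matrix.of fun i j => X (i, a.2) (j, b.2))
      (Matrix.of fun i j => Y (i, a.2) (j, b.2))) a.1) b.1
  map_smul' c X := by
    ext a b
    exact congrFun (congrFun (Λ.map_smul c (Matrix.of fun i j => X (i, a.2) (j, b.2))) a.1) b.1

/-- A quantum channel: a completely positive trace-preserving linear map. -/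
structure IsChannel {m n : Type*} [Fintype m] [Fintype n]
    (Λ : Matrix m m ℂ →ₗ[ℂ] Matrix n n ℂ) : Prop where
  completelyPositive : ∀ (k : ℕ) (X : Matrix (Fin k × m) (Fin k × m) ℂ),
    X.PosSemidef → (idTensor (Fin k) Λ X).PosSemidef
  tracePreserving : ∀ X : Matrix m m ℂ, (Λ X).trace = X.trace

/-- The tensor product `Λ ⊗ 𝓔 = (Λ ⊗ id) ∘ (id ⊗ 𝓔)` of two linear maps on matrices. -/
def tensor {m₁ n₁ m₂ n₂ : Type*} (Λ : Matrix m₁ m₁ ℂ →ₗ[ℂ] Matrix n₁ n₁ ℂ)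
    (𝓔 : Matrix m₂ m₂ ℂ →ₗ[ℂ] Matrix n₂ n₂ ℂ) :
    Matrix (m₁ × m₂) (m₁ × m₂) ℂ →ₗ[ℂ] Matrix (n₁ × n₂) (n₁ × n₂) ℂ :=
  tensorId Λ n₂ ∘ₗ idTensor m₁ 𝓔

/-- The defining property of the tensor product of maps. -/
theorem tensor_kronecker {m₁ n₁ m₂ n₂ : Type*} (Λ : Matrix m₁ m₁ ℂ →ₗ[ℂ] Matrix n₁ n₁ ℂ)
    (𝓔 : Matrix m₂ m₂ ℂ →ₗ[ℂ] Matrix n₂ n₂ ℂ) (A : Matrix m₁ m₁ ℂ) (B : Matrix m₂ m₂ ℂ) :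
    tensor Λ 𝓔 (A ⊗ₖ B) = Λ A ⊗ₖ 𝓔 B := by
  have h : ∀ a b, idTensor m₁ 𝓔 (A ⊗ₖ B) a b = 𝓔 B a.2 b.2 * A a.1 b.1 := by
    intro a b
    have := congrFun (congrFun (𝓔.map_smul (A a.1 b.1) B) a.2) b.2
    rw [mul_comm]
    exact this
  ext a b
  have h2 : (Matrix.of fun i j => idTensor m₁ 𝓔 (A ⊗ₖ B) (i, a.2) (j, b.2)) =
      𝓔 B a.2 b.2 • A := by
    ext i j
    simp [h]
  change Λ (Matrix.of fun i j => idTensor m₁ 𝓔 (A ⊗ₖ B) (i, a.2) (j, b.2)) a.1 b.1 = _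
  rw [h2, Λ.map_smul]
  simp [Matrix.kroneckerMap_apply, mul_comm]

/-- The set of all coherence increments `C(Λ(ρ)) - C(ρ)`, over all input states `ρ`. -/
def increments (C : CoherenceMeasure) {m n : Type*} [Fintype m] [DecidableEq m] [Fintype n]
    [DecidableEq n] (Λ : Matrix m m ℂ →ₗ[ℂ] Matrix n n ℂ) : Set ℝ :=
  {x : ℝ | ∃ ρ : Matrix m m ℂ, IsState ρ ∧ x = C.eval (Λ ρ) - C.eval ρ}

/-- The coherence increasing power `P_C(Λ) = sup_ρ [C(Λ(ρ)) - C(ρ)]`. -/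
def increasingPower (C : CoherenceMeasure) {m n : Type*} [Fintype m] [DecidableEq m] [Fintype n]
    [DecidableEq n] (Λ : Matrix m m ℂ →ₗ[ℂ] Matrix n n ℂ) : ℝ :=
  sSup (increments C Λ)

end

end Coherence

/-!
Both coherence measures are additive on product states, `C(ρ ⊗ σ) = C(ρ) + C(σ)`
(`CoherenceMeasure.eval_kronecker`), and bounded on the states of a given finite-dimensional space
(`CoherenceMeasure.abs_eval_le`). Boundedness makes the suprema finite, since `Λ ⊗ 𝓔` maps states
to states. By additivity, the increment of `Λ ⊗ 𝓔` on the input `ρ ⊗ σ` is the sum of the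
increments of `Λ` on `ρ` and of `𝓔` on `σ`, so every sum of increments is an increment of the
tensor product, and the suprema compare.

For the relative entropy of coherence, Gibbs' inequality shows that `Δ(ρ)` is the closest
incoherent state, so `C_r(ρ) = S(Δ(ρ)) - S(ρ)` (`IsState.relEntropyCoherence_eq`), and both terms
are additive because a product of diagonalisations diagonalises the product.

For the coherence of formation, the hard direction is superadditivity. A bipartite vector
measured in the product reference basis has outcomes `(X, Y)` with
`H(XY) = H(X) + H(Y|X) ≥ H(X|Y) + H(Y|X)`, and the two conditional entropies are the average
coherences of the vectors obtained by measuring one of the factors (`vecCoherence_slices_le`).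
Applied to each vector of a decomposition of `ρ ⊗ σ`, these measured vectors form decompositions
of `ρ` and of `σ`.
-/

namespace Coherence

open scoped Kronecker ComplexOrder
open Matrix

noncomputable section

/-! ### The Shannon entropy function and Gibbs' inequality -/

/-- The summand `-x log₂ x` of the Shannon entropy, with value `0` at `x = 0`. -/
def shannonTerm (x : ℝ) : ℝ := -(x * Real.logb 2 x)

theorem shannonTerm_mul (x y : ℝ) :
    shannonTerm (x * y) = y * shannonTerm x + x * shannonTerm y := by
  rcases eq_or_ne x 0 with rfl | hx
  · simp [shannonTerm]
  rcases eq_or_ne y 0 with rfl | hy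
  · simp [shannonTerm]
  rw [shannonTerm, shannonTerm, shannonTerm, Real.logb_mul hx hy]
  ring

theorem shannonTerm_one : shannonTerm 1 = 0 := by simp [shannonTerm]

theorem shannonTerm_eq_negMulLog (x : ℝ) : shannonTerm x = Real.negMulLog x / Real.log 2 := by
  simp only [shannonTerm, Real.negMulLog, Real.logb]
  ring

theorem shannonTerm_nonneg {x : ℝ} (h0 : 0 ≤ x) (h1 : x ≤ 1) : 0 ≤ shannonTerm x := by
  rw [shannonTerm_eq_negMulLog]
  exact div_nonneg (Real.negMulLog_nonneg h0 h1) (Real.log_nonneg one_le_two)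

theorem shannonTerm_le {x : ℝ} (h0 : 0 ≤ x) : shannonTerm x ≤ 1 / Real.log 2 := by
  rw [shannonTerm_eq_negMulLog]
  have := Real.negMulLog_le_one_sub_self h0
  have h2 : 0 ≤ Real.log 2 := Real.log_nonneg one_le_two
  gcongr
  linarith

/-- The tangent-line bound behind Gibbs' inequality. -/
theorem sub_div_log_two_le {p q : ℝ} (hp : 0 ≤ p) (hq : 0 ≤ q) (h : q = 0 → p = 0) :
    (p - q) / Real.log 2 ≤ p * (Real.logb 2 p - Real.logb 2 q) := by
  have h2 : 0 < Real.log 2 := Real.log_pos one_lt_two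
  rcases hp.eq_or_lt with rfl | hp
  · rw [zero_mul, zero_sub]
    exact div_nonpos_of_nonpos_of_nonneg (by linarith) h2.le
  have hq' : 0 < q := lt_of_le_of_ne hq fun h0 => hp.ne' (h h0.symm)
  have h3 : Real.log (q / p) ≤ q / p - 1 := Real.log_le_sub_one_of_pos (by positivity)
  rw [Real.log_div hq'.ne' hp.ne'] at h3
  have h4 : p * (Real.log q - Real.log p) ≤ q - p := by
    calc p * (Real.log q - Real.log p) ≤ p * (q / p - 1) := by gcongr
      _ = q - p := by field_simp
  rw [Real.logb, Real.logb, ← sub_div, ← mul_div_assoc]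
  gcongr
  linarith

/-- **Gibbs' inequality**. -/
theorem sum_mul_logb_le {ι : Type*} [Fintype ι] {p q : ι → ℝ} (hp : ∀ i, 0 ≤ p i)
    (hq : ∀ i, 0 ≤ q i) (h : ∀ i, q i = 0 → p i = 0) (hsum : ∑ i, p i = ∑ i, q i) :
    ∑ i, p i * Real.logb 2 (q i) ≤ ∑ i, p i * Real.logb 2 (p i) := by
  have := Finset.sum_le_sum fun i (_ : i ∈ Finset.univ) =>
    sub_div_log_two_le (hp i) (hq i) (h i)
  simp only [mul_sub, Finset.sum_sub_distrib, ← Finset.sum_div, hsum, sub_self, zero_div] at this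
  linarith

/-- Subadditivity of the Shannon entropy, for weights `q` that need not sum to `1`. -/
theorem shannon_subadditive {α β : Type*} [Fintype α] [Fintype β] (q : α → β → ℝ)
    (hq : ∀ x y, 0 ≤ q x y) :
    ∑ x, ∑ y, shannonTerm (q x y) + shannonTerm (∑ x, ∑ y, q x y) ≤
      ∑ x, shannonTerm (∑ y, q x y) + ∑ y, shannonTerm (∑ x, q x y) := by
  set a : α → ℝ := fun x => ∑ y, q x y with ha
  set b : β → ℝ := fun y => ∑ x, q x y with hb
  set Q : ℝ := ∑ x, a x with hQ
  have hQb : ∑ y, b y = Q := by rw [hQ, ha, hb]; exact Finset.sum_comm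
  have ha0 : ∀ x, 0 ≤ a x := fun x => Finset.sum_nonneg fun y _ => hq x y
  have hb0 : ∀ y, 0 ≤ b y := fun y => Finset.sum_nonneg fun x _ => hq x y
  have hQ0 : 0 ≤ Q := Finset.sum_nonneg fun x _ => ha0 x
  have hqa : ∀ x y, a x = 0 → q x y = 0 := fun x y h =>
    (Finset.sum_eq_zero_iff_of_nonneg fun y _ => hq x y).1 h y (Finset.mem_univ y)
  have hqb : ∀ x y, b y = 0 → q x y = 0 := fun x y h =>
    (Finset.sum_eq_zero_iff_of_nonneg fun x _ => hq x y).1 h x (Finset.mem_univ x)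
  have haQ : ∀ x, Q = 0 → a x = 0 := fun x h =>
    (Finset.sum_eq_zero_iff_of_nonneg fun x _ => ha0 x).1 h x (Finset.mem_univ x)
  -- Gibbs' inequality compares `q` with the product of its marginals.
  have key := sum_mul_logb_le (ι := α × β) (p := fun z => q z.1 z.2)
    (q := fun z => a z.1 * b z.2 / Q) (fun z => hq _ _)
    (fun z => div_nonneg (mul_nonneg (ha0 _) (hb0 _)) hQ0)
    (fun z h => by
      rcases div_eq_zero_iff.1 h with h | h
      · rcases mul_eq_zero.1 h with h | h
        · exact hqa _ _ h
        · exact hqb _ _ h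
      · exact hqa _ _ (haQ _ h))
    (by
      simp only [Fintype.sum_prod_type, mul_div_assoc, ← Finset.mul_sum, ← Finset.sum_div, hQb]
      rcases eq_or_ne Q 0 with h | h
      · simp [h, ← hQ, ← ha]
      · simp [div_self h, ha])
  have hlog : ∀ x y, q x y * Real.logb 2 (a x * b y / Q) =
      q x y * Real.logb 2 (a x) + q x y * Real.logb 2 (b y) - q x y * Real.logb 2 Q := by
    intro x y
    rcases eq_or_ne (q x y) 0 with h | h
    · simp [h]
    have h1 : a x ≠ 0 := fun h' => h (hqa x y h')
    have h2 : b y ≠ 0 := fun h' => h (hqb x y h')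
    have h3 : Q ≠ 0 := fun h' => h1 (haQ x h')
    rw [Real.logb_div (mul_ne_zero h1 h2) h3, Real.logb_mul h1 h2]
    ring
  simp only [Fintype.sum_prod_type, hlog, Finset.sum_sub_distrib, Finset.sum_add_distrib,
    ← Finset.sum_mul] at key
  have e1 : ∑ x, ∑ y, q x y * Real.logb 2 (b y) = ∑ y, b y * Real.logb 2 (b y) := by
    rw [Finset.sum_comm]
    simp only [hb, Finset.sum_mul]
  rw [e1] at key
  simp only [shannonTerm, Finset.sum_neg_distrib]
  simp only [← ha, ← hQ] at key ⊢
  linarith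

/-! ### Entropy of diagonalised matrices -/

section

variable {n : Type*} [Fintype n] [DecidableEq n]

/-- The algebra homomorphism `d ↦ U diag(d) U*` for a unitary matrix `U`. -/
def unitaryDiagonal (U : unitary (Matrix n n ℂ)) : (n → ℝ) →ₐ[ℝ] Matrix n n ℂ :=
  ((Unitary.conjStarAlgAut ℝ (Matrix n n ℂ) U).toAlgEquiv.toAlgHom.comp
    (diagonalAlgHom ℝ)).comp (AlgHom.compLeft Complex.ofRealAm n)

theorem unitaryDiagonal_apply (U : unitary (Matrix n n ℂ)) (d : n → ℝ) :
    unitaryDiagonal U d = U * diagonal (fun i => (d i : ℂ)) * star (U : Matrix n n ℂ) := rfl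

theorem unitaryDiagonal_one (d : n → ℝ) :
    unitaryDiagonal 1 d = diagonal (fun i => (d i : ℂ)) := by
  simp [unitaryDiagonal_apply]

theorem isSelfAdjoint_unitaryDiagonal (U : unitary (Matrix n n ℂ)) (d : n → ℝ) :
    IsSelfAdjoint (unitaryDiagonal U d) := by
  rw [unitaryDiagonal_apply, isSelfAdjoint_iff, star_mul, star_mul, star_star,
    star_eq_conjTranspose (diagonal _), diagonal_conjTranspose, mul_assoc]
  congr
  ext i
  simp

/-- The functional calculus acts on the diagonal entries of any diagonalisation. The spectrum is
finite, so the function may be replaced by an interpolating polynomial, and polynomials commute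
with algebra homomorphisms. -/
theorem cfc_unitaryDiagonal (f : ℝ → ℝ) (U : unitary (Matrix n n ℂ)) (d : n → ℝ) :
    cfc f (unitaryDiagonal U d) = unitaryDiagonal U (f ∘ d) := by
  set q : Polynomial ℝ := Lagrange.interpolate (Finset.univ.image d) id f with hq
  have hqd : ∀ i, q.eval (d i) = f (d i) := fun i =>
    Lagrange.eval_interpolate_at_node f (Set.injOn_id _)
      (Finset.mem_image_of_mem d (Finset.mem_univ i))
  have hspec : spectrum ℝ (unitaryDiagonal U d) ⊆ Set.range d := by
    refine (AlgHom.spectrum_apply_subset _ _).trans ?_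
    rw [Pi.spectrum_eq]
    refine Set.iUnion_subset fun i x hx => ⟨i, ?_⟩
    have : spectrum ℝ (d i) = {d i} := spectrum.scalar_eq (𝕜 := ℝ) (A := ℝ) (d i)
    rw [this] at hx
    exact hx.symm
  have h1 : cfc f (unitaryDiagonal U d) = cfc q.eval (unitaryDiagonal U d) := by
    refine cfc_congr fun x hx => ?_
    obtain ⟨i, rfl⟩ := hspec hx
    exact (hqd i).symm
  rw [h1, cfc_polynomial q _ (isSelfAdjoint_unitaryDiagonal U d), Polynomial.aeval_algHom_apply]
  congr 1
  ext i
  have := (Polynomial.aeval_algHom_apply (Pi.evalAlgHom ℝ (fun _ : n => ℝ) i) d q).symm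
  simp only [Pi.evalAlgHom_apply, Polynomial.coe_aeval_eq_eval] at this
  rw [this, Function.comp_apply, hqd]

theorem entropy_unitaryDiagonal (U : unitary (Matrix n n ℂ)) (d : n → ℝ) :
    entropy (unitaryDiagonal U d) = ∑ i, shannonTerm (d i) := by
  rw [entropy, log2, cfc_unitaryDiagonal, ← map_mul, unitaryDiagonal_apply, trace_mul_comm,
    ← mul_assoc, Unitary.coe_star_mul_self, one_mul, trace_diagonal, ← Complex.ofReal_sum]
  simp [shannonTerm]

theorem log2_diagonal (d : n → ℝ) : log2 (diagonal fun i => (d i : ℂ)) =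
    diagonal fun i => ((Real.logb 2 (d i) : ℝ) : ℂ) := by
  rw [log2, ← unitaryDiagonal_one, cfc_unitaryDiagonal, unitaryDiagonal_one]
  rfl

theorem entropy_diagonal (d : n → ℝ) :
    entropy (diagonal fun i => (d i : ℂ)) = ∑ i, shannonTerm (d i) := by
  rw [← unitaryDiagonal_one, entropy_unitaryDiagonal]

omit [DecidableEq n] in
theorem IsState.nonneg_diag {ρ : Matrix n n ℂ} (h : IsState ρ) (i : n) : 0 ≤ (ρ i i).re := by
  exact (Complex.nonneg_iff.1 h.1.diag_nonneg).1

omit [DecidableEq n] in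
theorem IsState.diag_eq {ρ : Matrix n n ℂ} (h : IsState ρ) (i : n) :
    ρ i i = ((ρ i i).re : ℂ) :=
  Complex.eq_re_of_ofReal_le h.1.diag_nonneg

omit [DecidableEq n] in
theorem IsState.sum_diag {ρ : Matrix n n ℂ} (h : IsState ρ) : ∑ i, (ρ i i).re = 1 := by
  have := congrArg Complex.re h.2
  simpa [trace] using this

theorem IsState.dephase_eq {ρ : Matrix n n ℂ} (h : IsState ρ) :
    dephase ρ = diagonal fun i => ((ρ i i).re : ℂ) := by
  rw [dephase]
  congr 1
  ext i
  exact h.diag_eq i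

theorem IsState.isState_dephase {ρ : Matrix n n ℂ} (h : IsState ρ) : IsState (dephase ρ) := by
  refine ⟨PosSemidef.diagonal fun i => h.1.diag_nonneg, ?_⟩
  rw [dephase, trace_diagonal]
  exact h.2

/-- Every state is diagonalised by a unitary, with a probability vector as its spectrum. -/
theorem IsState.exists_unitaryDiagonal {ρ : Matrix n n ℂ} (h : IsState ρ) :
    ∃ (U : unitary (Matrix n n ℂ)) (d : n → ℝ),
      ρ = unitaryDiagonal U d ∧ (∀ i, 0 ≤ d i) ∧ ∑ i, d i = 1 := by
  have hH := h.1.isHermitian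
  refine ⟨hH.eigenvectorUnitary, hH.eigenvalues, hH.spectral_theorem, h.1.eigenvalues_nonneg, ?_⟩
  have := hH.trace_eq_sum_eigenvalues
  rw [h.2] at this
  have := congrArg Complex.re this
  simpa using this.symm

theorem IsState.entropy_nonneg {ρ : Matrix n n ℂ} (h : IsState ρ) : 0 ≤ entropy ρ := by
  obtain ⟨U, d, rfl, h0, h1⟩ := h.exists_unitaryDiagonal
  rw [entropy_unitaryDiagonal]
  refine Finset.sum_nonneg fun i _ => shannonTerm_nonneg (h0 i) ?_
  rw [← h1]
  exact Finset.single_le_sum (fun j _ => h0 j) (Finset.mem_univ i)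

theorem IsState.entropy_le {ρ : Matrix n n ℂ} (h : IsState ρ) :
    entropy ρ ≤ Fintype.card n * (1 / Real.log 2) := by
  obtain ⟨U, d, rfl, h0, h1⟩ := h.exists_unitaryDiagonal
  rw [entropy_unitaryDiagonal]
  refine (Finset.sum_le_sum fun i _ => shannonTerm_le (h0 i)).trans ?_
  simp

variable {m : Type*} [Fintype m] [DecidableEq m]

omit [DecidableEq n] [DecidableEq m] in
theorem IsState.kronecker {ρ : Matrix m m ℂ} {σ : Matrix n n ℂ} (hρ : IsState ρ)
    (hσ : IsState σ) : IsState (ρ ⊗ₖ σ) := by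
  refine ⟨hρ.1.kronecker hσ.1, ?_⟩
  rw [trace_kronecker, hρ.2, hσ.2, one_mul]

theorem unitaryDiagonal_kronecker (U : unitary (Matrix m m ℂ)) (V : unitary (Matrix n n ℂ))
    (d : m → ℝ) (e : n → ℝ) :
    unitaryDiagonal U d ⊗ₖ unitaryDiagonal V e =
      unitaryDiagonal ⟨(U : Matrix m m ℂ) ⊗ₖ (V : Matrix n n ℂ), kronecker_mem_unitary U.2 V.2⟩
        (fun z => d z.1 * e z.2) := by
  simp only [unitaryDiagonal_apply, mul_kronecker_mul, diagonal_kronecker_diagonal,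
    star_eq_conjTranspose, conjTranspose_kronecker, Complex.ofReal_mul]

theorem IsState.entropy_kronecker {ρ : Matrix m m ℂ} {σ : Matrix n n ℂ} (hρ : IsState ρ)
    (hσ : IsState σ) : entropy (ρ ⊗ₖ σ) = entropy ρ + entropy σ := by
  obtain ⟨U, d, rfl, -, hd⟩ := hρ.exists_unitaryDiagonal
  obtain ⟨V, e, rfl, -, he⟩ := hσ.exists_unitaryDiagonal
  simp only [unitaryDiagonal_kronecker, entropy_unitaryDiagonal, shannonTerm_mul,
    Fintype.sum_prod_type, Finset.sum_add_distrib, ← Finset.sum_mul, ← Finset.mul_sum, hd, he,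
    one_mul]

end

/-! ### The relative entropy of coherence -/

section

variable {n : Type*} [Fintype n] [DecidableEq n]

/-- A state kills the basis vectors on which its diagonal vanishes. -/
theorem IsState.apply_eq_zero {ρ : Matrix n n ℂ} (h : IsState ρ) {j : n} (hj : ρ j j = 0)
    (i : n) : ρ i j = 0 := by
  have := (h.1.dotProduct_mulVec_zero_iff (Pi.single j 1)).1 (by simp [hj])
  simpa using congrFun this i

theorem trace_mul_log2_sub_log2_diagonal (ρ : Matrix n n ℂ) (q : n → ℝ) :
    (ρ * (log2 ρ - log2 (diagonal fun i => (q i : ℂ)))).trace.re =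
      -entropy ρ - ∑ i, (ρ i i).re * Real.logb 2 (q i) := by
  rw [mul_sub, trace_sub, Complex.sub_re, entropy, neg_neg, log2_diagonal]
  simp only [trace, diag_apply, mul_diagonal, Complex.re_sum, Complex.re_mul_ofReal]

/-- The closest incoherent state to `ρ` is `Δ(ρ)`. -/
theorem IsState.relEntropyCoherence_eq {ρ : Matrix n n ℂ} (h : IsState ρ) :
    relEntropyCoherence ρ = entropy (dephase ρ) - entropy ρ := by
  have hΔ : entropy (dephase ρ) = -∑ i, (ρ i i).re * Real.logb 2 (ρ i i).re := by
    rw [h.dephase_eq, entropy_diagonal]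
    simp [shannonTerm]
  refine IsLeast.csInf_eq ⟨⟨dephase ρ, ⟨h.isState_dephase, isDiag_diagonal _⟩, ?_⟩, ?_⟩
  · rw [relEntropy, if_pos]
    · rw [h.dephase_eq, trace_mul_log2_sub_log2_diagonal, ← h.dephase_eq, hΔ]
      congr 1
      ring
    · intro v hv
      ext i
      refine Finset.sum_eq_zero fun j _ => ?_
      have hj : ρ j j * v j = 0 := by simpa [dephase, mulVec_diagonal] using congrFun hv j
      change ρ i j * v j = 0
      rcases mul_eq_zero.1 hj with h0 | h0
      · rw [h.apply_eq_zero h0, zero_mul]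
      · rw [h0, mul_zero]
  · rintro r ⟨σ, ⟨hσ, hdiag⟩, hr⟩
    have hσd : σ = diagonal fun i => ((σ i i).re : ℂ) := by
      rw [← hσ.dephase_eq]
      exact hdiag.diagonal_diag.symm
    rw [relEntropy] at hr
    split_ifs at hr with hker
    · rw [EReal.coe_eq_coe_iff, hσd, trace_mul_log2_sub_log2_diagonal] at hr
      have hsupp : ∀ i, (σ i i).re = 0 → (ρ i i).re = 0 := by
        intro i hi
        have h1 := hker (Pi.single i 1) (by
          rw [hσd]
          ext j
          simp [hi])
        have h2 := congrFun h1 i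
        simp only [mulVec_single_one, col_apply, Pi.zero_apply] at h2
        rw [h2, Complex.zero_re]
      have := sum_mul_logb_le h.nonneg_diag hσ.nonneg_diag hsupp (by rw [h.sum_diag, hσ.sum_diag])
      linarith
    · exact absurd hr.symm (EReal.coe_ne_top r)

variable {m : Type*} [Fintype m] [DecidableEq m]

theorem IsState.relEntropyCoherence_kronecker {ρ : Matrix m m ℂ} {σ : Matrix n n ℂ}
    (hρ : IsState ρ) (hσ : IsState σ) : relEntropyCoherence (ρ ⊗ₖ σ) =
      relEntropyCoherence ρ + relEntropyCoherence σ := by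
  have hΔ : dephase (ρ ⊗ₖ σ) = dephase ρ ⊗ₖ dephase σ := by
    simp only [dephase, diagonal_kronecker_diagonal]
    rfl
  rw [hρ.relEntropyCoherence_eq, hσ.relEntropyCoherence_eq,
    (hρ.kronecker hσ).relEntropyCoherence_eq, hΔ, hρ.entropy_kronecker hσ,
    hρ.isState_dephase.entropy_kronecker hσ.isState_dephase]
  ring

theorem IsState.abs_relEntropyCoherence_le {ρ : Matrix n n ℂ} (h : IsState ρ) :
    |relEntropyCoherence ρ| ≤ Fintype.card n * (1 / Real.log 2) := by
  rw [h.relEntropyCoherence_eq, abs_le]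
  have h1 := h.entropy_nonneg
  have h2 := h.entropy_le
  have h3 := h.isState_dephase.entropy_nonneg
  have h4 := h.isState_dephase.entropy_le
  constructor <;> linarith

end

/-! ### The coherence of formation -/

section

variable {n : Type*} [Fintype n]

/-- The coherence `S(Δ(|v⟩⟨v|))` of a unit vector, extended to all vectors so as to be homogeneous
of degree one in `|v⟩⟨v|`. With it, the weights of a pure state decomposition can be absorbed into
the vectors, and vectors of weight zero need no special treatment. -/
def vecCoherence (v : n → ℂ) : ℝ :=
  ∑ x, shannonTerm (‖v x‖ ^ 2) - shannonTerm (∑ x, ‖v x‖ ^ 2)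

theorem vecCoherence_smul (c : ℂ) (v : n → ℂ) :
    vecCoherence (c • v) = ‖c‖ ^ 2 * vecCoherence v := by
  simp only [vecCoherence, Pi.smul_apply, smul_eq_mul, norm_mul, mul_pow, ← Finset.mul_sum,
    shannonTerm_mul, Finset.sum_add_distrib, ← Finset.sum_mul]
  ring

theorem mul_star_self_eq (c : ℂ) : c * star c = ((‖c‖ ^ 2 : ℝ) : ℂ) := by
  rw [Complex.star_def, Complex.mul_conj, Complex.normSq_eq_norm_sq]

omit [Fintype n] in
theorem pureState_smul (c : ℂ) (v : n → ℂ) :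
    pureState (c • v) = ((‖c‖ ^ 2 : ℝ) : ℂ) • pureState v := by
  ext i j
  simp only [pureState, vecMulVec_apply, Pi.smul_apply, Pi.star_apply, smul_eq_mul, star_mul',
    Matrix.smul_apply, ← mul_star_self_eq]
  ring

theorem trace_pureState (v : n → ℂ) :
    (pureState v).trace = ((∑ x, ‖v x‖ ^ 2 : ℝ) : ℂ) := by
  simp only [pureState, trace, diag_apply, vecMulVec_apply, Pi.star_apply, mul_star_self_eq]
  push_cast
  rfl

theorem isState_pureState {v : n → ℂ} (h : ∑ x, ‖v x‖ ^ 2 = 1) : IsState (pureState v) :=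
  ⟨posSemidef_vecMulVec_self_star v, by rw [trace_pureState, h, Complex.ofReal_one]⟩

/-- `ρ` is the sum of the rank-one operators of the vectors `v i`: a decomposition into weighted
pure states whose weights `‖v i‖²` are absorbed into the vectors. -/
def IsVecDecomposition {ι : Type*} [Fintype ι] (ρ : Matrix n n ℂ) (v : ι → n → ℂ) : Prop :=
  ρ = ∑ i, pureState (v i)

omit [Fintype n] in
theorem IsVecDecomposition.apply_eq {ι : Type*} [Fintype ι] {ρ : Matrix n n ℂ} {v : ι → n → ℂ}
    (h : IsVecDecomposition ρ v) (x x' : n) : ρ x x' = ∑ i, v i x * star (v i x') := by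
  rw [h, Matrix.sum_apply]
  rfl

theorem IsVecDecomposition.sum_norm {ι : Type*} [Fintype ι] {ρ : Matrix n n ℂ} {v : ι → n → ℂ}
    (h : IsVecDecomposition ρ v) (hρ : ρ.trace = 1) : ∑ i, ∑ x, ‖v i x‖ ^ 2 = 1 := by
  rw [h, trace_sum] at hρ
  simp only [trace_pureState] at hρ
  exact_mod_cast hρ

variable [DecidableEq n]

theorem entropy_dephase_pureState {v : n → ℂ} (h : ∑ x, ‖v x‖ ^ 2 = 1) :
    entropy (dephase (pureState v)) = vecCoherence v := by
  have : ∀ x, ((pureState v) x x).re = ‖v x‖ ^ 2 := fun x => by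
    rw [pureState, vecMulVec_apply, Pi.star_apply, mul_star_self_eq, Complex.ofReal_re]
  rw [(isState_pureState h).dephase_eq, entropy_diagonal]
  simp only [this, vecCoherence, h, shannonTerm_one, sub_zero]

theorem IsPureDecomposition.sum_mem_Icc {ρ : Matrix n n ℂ} {k : ℕ} {p : Fin k → ℝ}
    {ψ : Fin k → n → ℂ} (h : IsPureDecomposition ρ p ψ) :
    ∑ i, p i * entropy (dephase (pureState (ψ i))) ∈
      Set.Icc 0 (Fintype.card n * (1 / Real.log 2)) := by
  have hs := fun i => (isState_pureState (h.unit i)).isState_dephase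
  refine ⟨Finset.sum_nonneg fun i _ => mul_nonneg (h.nonneg i) (hs i).entropy_nonneg, ?_⟩
  refine (Finset.sum_le_sum fun i _ =>
    mul_le_mul_of_nonneg_left (hs i).entropy_le (h.nonneg i)).trans_eq ?_
  rw [← Finset.sum_mul, h.sum_eq_one, one_mul]

omit [DecidableEq n] in
theorem IsPureDecomposition.isVecDecomposition {ρ : Matrix n n ℂ} {k : ℕ} {p : Fin k → ℝ}
    {ψ : Fin k → n → ℂ} (h : IsPureDecomposition ρ p ψ) :
    IsVecDecomposition ρ (fun i => (Real.sqrt (p i) : ℂ) • ψ i) := by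
  rw [IsVecDecomposition, h.eq_sum]
  refine Finset.sum_congr rfl fun i _ => ?_
  rw [pureState_smul, Complex.norm_real, Real.norm_eq_abs, sq_abs, Real.sq_sqrt (h.nonneg i)]

theorem IsPureDecomposition.sum_vecCoherence {ρ : Matrix n n ℂ} {k : ℕ} {p : Fin k → ℝ}
    {ψ : Fin k → n → ℂ} (h : IsPureDecomposition ρ p ψ) :
    ∑ i, vecCoherence ((Real.sqrt (p i) : ℂ) • ψ i) =
      ∑ i, p i * entropy (dephase (pureState (ψ i))) := by
  refine Finset.sum_congr rfl fun i _ => ?_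
  rw [vecCoherence_smul, Complex.norm_real, Real.norm_eq_abs, sq_abs, Real.sq_sqrt (h.nonneg i),
    entropy_dephase_pureState (h.unit i)]

/-- Every vector is a nonnegative multiple of a unit vector. -/
theorem exists_unit_vector [Nonempty n] (v : n → ℂ) : ∃ ψ : n → ℂ,
    ∑ x, ‖ψ x‖ ^ 2 = 1 ∧ v = ((Real.sqrt (∑ x, ‖v x‖ ^ 2) : ℝ) : ℂ) • ψ := by
  have h0 : 0 ≤ ∑ x, ‖v x‖ ^ 2 := Finset.sum_nonneg fun x _ => by positivity
  rcases h0.eq_or_lt with h | h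
  · obtain ⟨a⟩ := ‹Nonempty n›
    refine ⟨Pi.single a 1, ?_, ?_⟩
    · rw [Finset.sum_eq_single a] <;> simp +contextual
    · rw [← h]
      ext x
      have := (Finset.sum_eq_zero_iff_of_nonneg fun x _ => by positivity).1 h.symm x
        (Finset.mem_univ x)
      simpa using this
  · have hs := Real.sqrt_pos.2 h
    refine ⟨((Real.sqrt (∑ x, ‖v x‖ ^ 2) : ℝ) : ℂ)⁻¹ • v, ?_, ?_⟩
    · simp only [Pi.smul_apply, smul_eq_mul, norm_mul, norm_inv, Complex.norm_real, mul_pow,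
        ← Finset.mul_sum, Real.norm_eq_abs, inv_pow, sq_abs, Real.sq_sqrt h0]
      exact inv_mul_cancel₀ h.ne'
    · rw [smul_inv_smul₀]
      exact_mod_cast hs.ne'

theorem IsPureDecomposition.coherenceOfFormation_le {ρ : Matrix n n ℂ} {k : ℕ} {p : Fin k → ℝ}
    {ψ : Fin k → n → ℂ} (h : IsPureDecomposition ρ p ψ) :
    coherenceOfFormation ρ ≤ ∑ i, p i * entropy (dephase (pureState (ψ i))) := by
  refine csInf_le ⟨0, ?_⟩ ⟨k, p, ψ, h, rfl⟩
  rintro r ⟨k, p, ψ, hd, rfl⟩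
  exact hd.sum_mem_Icc.1

/-- Any finite family of unnormalised vectors decomposing `ρ` bounds the coherence of formation:
normalising the vectors turns it into a pure state decomposition. -/
theorem coherenceOfFormation_le {ρ : Matrix n n ℂ} (hρ : ρ.trace = 1) {ι : Type*} [Fintype ι]
    {v : ι → n → ℂ} (h : IsVecDecomposition ρ v) :
    coherenceOfFormation ρ ≤ ∑ i, vecCoherence (v i) := by
  have : Nonempty n := by
    by_contra hn
    rw [not_nonempty_iff] at hn
    simp [trace] at hρ
  choose ψ hψ hv using fun i => exists_unit_vector (v i)
  set p : ι → ℝ := fun i => ∑ x, ‖v i x‖ ^ 2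
  have hp0 : ∀ i, 0 ≤ p i := fun i => Finset.sum_nonneg fun x _ => by positivity
  set e := (Fintype.equivFin ι).symm
  have hdec : IsPureDecomposition ρ (fun i => p (e i)) (fun i => ψ (e i)) := by
    refine ⟨fun i => hp0 _, ?_, fun i => hψ _, ?_⟩
    · rw [e.sum_comp p]
      exact h.sum_norm hρ
    · rw [e.sum_comp fun i => ((p i : ℝ) : ℂ) • pureState (ψ i), h]
      refine Finset.sum_congr rfl fun i _ => ?_
      conv_lhs => rw [hv i]
      rw [pureState_smul, Complex.norm_real, Real.norm_eq_abs, sq_abs, Real.sq_sqrt (hp0 i)]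
  refine hdec.coherenceOfFormation_le.trans_eq ?_
  rw [e.sum_comp fun i => p i * entropy (dephase (pureState (ψ i)))]
  refine Finset.sum_congr rfl fun i _ => ?_
  conv_rhs => rw [hv i]
  rw [vecCoherence_smul, Complex.norm_real, Real.norm_eq_abs, sq_abs, Real.sq_sqrt (hp0 i),
    entropy_dephase_pureState (hψ i)]

/-- The spectral decomposition of a state is a decomposition into pure states. -/
theorem IsState.exists_isPureDecomposition {ρ : Matrix n n ℂ} (h : IsState ρ) :
    ∃ (k : ℕ) (p : Fin k → ℝ) (ψ : Fin k → n → ℂ), IsPureDecomposition ρ p ψ := by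
  obtain ⟨U, d, hd, h0, h1⟩ := h.exists_unitaryDiagonal
  set e := (Fintype.equivFin n).symm
  refine ⟨_, fun i => d (e i), fun i x => (U : Matrix n n ℂ) x (e i), fun i => h0 _, ?_, ?_, ?_⟩
  · rw [e.sum_comp d, h1]
  · intro i
    have := congrFun (congrFun (Unitary.coe_star_mul_self U) (e i)) (e i)
    simp only [star_eq_conjTranspose, mul_apply, conjTranspose_apply, one_apply_eq] at this
    have h2 : ∀ x, star ((U : Matrix n n ℂ) x (e i)) * (U : Matrix n n ℂ) x (e i) =
        ((‖(U : Matrix n n ℂ) x (e i)‖ ^ 2 : ℝ) : ℂ) := fun x => by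
      rw [mul_comm, mul_star_self_eq]
    simp only [h2] at this
    exact_mod_cast this
  · rw [e.sum_comp fun i => (d i : ℂ) • pureState fun x => (U : Matrix n n ℂ) x i, hd]
    ext x y
    rw [unitaryDiagonal_apply, mul_apply, Matrix.sum_apply]
    refine Finset.sum_congr rfl fun i _ => ?_
    simp [mul_diagonal, pureState, vecMulVec_apply]
    ring

theorem IsState.abs_coherenceOfFormation_le {ρ : Matrix n n ℂ} (h : IsState ρ) :
    |coherenceOfFormation ρ| ≤ Fintype.card n * (1 / Real.log 2) := by
  obtain ⟨k, p, ψ, hd⟩ := h.exists_isPureDecomposition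
  rw [abs_of_nonneg]
  · exact hd.coherenceOfFormation_le.trans hd.sum_mem_Icc.2
  · refine Real.sInf_nonneg ?_
    rintro r ⟨k, p, ψ, hd, rfl⟩
    exact hd.sum_mem_Icc.1

variable {m : Type*} [Fintype m]

omit [DecidableEq n] in
/-- Chain rule for a bipartite vector: `H(XY) = H(X) + H(Y|X) ≥ H(X|Y) + H(Y|X)` for the
distribution of the outcomes of measuring both factors in the reference bases. -/
theorem vecCoherence_slices_le (v : m × n → ℂ) :
    ∑ y, vecCoherence (fun x => v (x, y)) + ∑ x, vecCoherence (fun y => v (x, y)) ≤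
      vecCoherence v := by
  have := shannon_subadditive (fun x y => ‖v (x, y)‖ ^ 2) fun x y => by positivity
  have hc : ∑ y, ∑ x, shannonTerm (‖v (x, y)‖ ^ 2) = ∑ x, ∑ y, shannonTerm (‖v (x, y)‖ ^ 2) :=
    Finset.sum_comm
  simp only [vecCoherence, Finset.sum_sub_distrib, Fintype.sum_prod_type, hc]
  linarith

omit [DecidableEq n] [Fintype m] in
/-- Projecting the second factor of a decomposition of `ρ ⊗ σ` onto its reference basis vectors
decomposes the marginal `ρ`. -/
theorem IsVecDecomposition.left {ι : Type*} [Fintype ι] {ρ : Matrix m m ℂ} {σ : Matrix n n ℂ}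
    (hσ : σ.trace = 1) {v : ι → m × n → ℂ} (h : IsVecDecomposition (ρ ⊗ₖ σ) v) :
    IsVecDecomposition ρ (fun (z : ι × n) x => v z.1 (x, z.2)) := by
  ext x x'
  rw [Matrix.sum_apply, Fintype.sum_prod_type, Finset.sum_comm]
  calc ρ x x' = ∑ y, ρ x x' * σ y y := by
        rw [← Finset.mul_sum]
        exact (mul_one _).symm.trans (congrArg _ hσ.symm)
    _ = _ := Finset.sum_congr rfl fun y _ => h.apply_eq (x, y) (x', y)

omit [DecidableEq n] [Fintype n] in
/-- The analogue of `IsVecDecomposition.left` for the marginal `σ`. -/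
theorem IsVecDecomposition.right {ι : Type*} [Fintype ι] {ρ : Matrix m m ℂ} {σ : Matrix n n ℂ}
    (hρ : ρ.trace = 1) {v : ι → m × n → ℂ} (h : IsVecDecomposition (ρ ⊗ₖ σ) v) :
    IsVecDecomposition σ (fun (z : ι × m) y => v z.1 (z.2, y)) := by
  ext y y'
  rw [Matrix.sum_apply, Fintype.sum_prod_type, Finset.sum_comm]
  calc σ y y' = ∑ x, ρ x x * σ y y' := by
        rw [← Finset.sum_mul]
        exact (one_mul _).symm.trans (congrArg (· * _) hρ.symm)
    _ = _ := Finset.sum_congr rfl fun x _ => h.apply_eq (x, y) (x, y')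

omit [DecidableEq n] in
theorem vecCoherence_tensor (v : m → ℂ) (w : n → ℂ) :
    vecCoherence (fun z : m × n => v z.1 * w z.2) =
      (∑ y, ‖w y‖ ^ 2) * vecCoherence v + (∑ x, ‖v x‖ ^ 2) * vecCoherence w := by
  simp only [vecCoherence, norm_mul, mul_pow, Fintype.sum_prod_type, shannonTerm_mul,
    Finset.sum_add_distrib, ← Finset.sum_mul, ← Finset.mul_sum]
  ring

omit [DecidableEq n] [Fintype n] [Fintype m] in
theorem IsVecDecomposition.tensor {ι κ : Type*} [Fintype ι] [Fintype κ] {ρ : Matrix m m ℂ}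
    {σ : Matrix n n ℂ} {v : ι → m → ℂ} {w : κ → n → ℂ} (hv : IsVecDecomposition ρ v)
    (hw : IsVecDecomposition σ w) :
    IsVecDecomposition (ρ ⊗ₖ σ) (fun (i : ι × κ) (z : m × n) => v i.1 z.1 * w i.2 z.2) := by
  ext z z'
  rw [kroneckerMap_apply, hv.apply_eq, hw.apply_eq, Finset.sum_mul_sum, Matrix.sum_apply,
    Fintype.sum_prod_type]
  refine Finset.sum_congr rfl fun i _ => Finset.sum_congr rfl fun j _ => ?_
  simp only [pureState, vecMulVec_apply, Pi.star_apply, star_mul']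
  ring

variable [DecidableEq m]

/-- Additivity on product states. Tensoring decompositions gives `≤`. For `≥`, slicing the vectors
of a decomposition of `ρ ⊗ σ` along either factor decomposes both marginals, at no higher total
coherence by `vecCoherence_slices_le`. -/
theorem IsState.coherenceOfFormation_kronecker {ρ : Matrix m m ℂ} {σ : Matrix n n ℂ}
    (hρ : IsState ρ) (hσ : IsState σ) : coherenceOfFormation (ρ ⊗ₖ σ) =
      coherenceOfFormation ρ + coherenceOfFormation σ := by
  apply le_antisymm
  · obtain ⟨k, p, ψ, hd⟩ := hρ.exists_isPureDecomposition
    obtain ⟨k', p', ψ', hd'⟩ := hσ.exists_isPureDecomposition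
    -- Tensor products of decompositions bound `C_f(ρ ⊗ σ)`; take the infimum over each factor.
    rw [← sub_le_iff_le_add]
    refine le_csInf ⟨_, k, p, ψ, hd, rfl⟩ ?_
    rintro r ⟨k, p, ψ, hd, rfl⟩
    rw [sub_le_comm]
    refine le_csInf ⟨_, k', p', ψ', hd', rfl⟩ ?_
    rintro r ⟨k', p', ψ', hd', rfl⟩
    rw [sub_le_iff_le_add']
    have h1 := hd.isVecDecomposition
    have h2 := hd'.isVecDecomposition
    refine (coherenceOfFormation_le (hρ.kronecker hσ).2 (h1.tensor h2)).trans_eq ?_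
    rw [← hd.sum_vecCoherence, ← hd'.sum_vecCoherence]
    simp only [vecCoherence_tensor, Fintype.sum_prod_type, Finset.sum_add_distrib,
      ← Finset.sum_mul, ← Finset.mul_sum, h1.sum_norm hρ.2, h2.sum_norm hσ.2, one_mul]
  · obtain ⟨k, p, ψ, hd⟩ := (hρ.kronecker hσ).exists_isPureDecomposition
    refine le_csInf ⟨_, k, p, ψ, hd, rfl⟩ ?_
    rintro r ⟨k, p, ψ, hd, rfl⟩
    have h := hd.isVecDecomposition
    rw [← hd.sum_vecCoherence]
    set v := fun i => (Real.sqrt (p i) : ℂ) • ψ i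
    change _ ≤ ∑ i, vecCoherence (v i)
    clear_value v
    refine (add_le_add (coherenceOfFormation_le hρ.2 (h.left hσ.2))
      (coherenceOfFormation_le hσ.2 (h.right hρ.2))).trans ?_
    rw [Fintype.sum_prod_type, Fintype.sum_prod_type, ← Finset.sum_add_distrib]
    exact Finset.sum_le_sum fun i _ => vecCoherence_slices_le (v i)

end

/-! ### Coherence measures and channels -/

theorem CoherenceMeasure.eval_kronecker (C : CoherenceMeasure) {m n : Type*} [Fintype m]
    [DecidableEq m] [Fintype n] [DecidableEq n] {ρ : Matrix m m ℂ} {σ : Matrix n n ℂ}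
    (hρ : IsState ρ) (hσ : IsState σ) : C.eval (ρ ⊗ₖ σ) = C.eval ρ + C.eval σ := by
  cases C
  · exact hρ.relEntropyCoherence_kronecker hσ
  · exact hρ.coherenceOfFormation_kronecker hσ

theorem CoherenceMeasure.abs_eval_le (C : CoherenceMeasure) {n : Type*} [Fintype n]
    [DecidableEq n] {ρ : Matrix n n ℂ} (h : IsState ρ) :
    |C.eval ρ| ≤ Fintype.card n * (1 / Real.log 2) := by
  cases C
  · exact h.abs_relEntropyCoherence_le
  · exact h.abs_coherenceOfFormation_le

theorem exists_isState (n : Type*) [Fintype n] [DecidableEq n] [Nonempty n] :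
    ∃ ρ : Matrix n n ℂ, IsState ρ := by
  obtain ⟨ψ, hψ, -⟩ := exists_unit_vector (0 : n → ℂ)
  exact ⟨_, isState_pureState hψ⟩

theorem bddAbove_increments (C : CoherenceMeasure) {m n : Type*} [Fintype m] [DecidableEq m]
    [Fintype n] [DecidableEq n] {Λ : Matrix m m ℂ →ₗ[ℂ] Matrix n n ℂ}
    (hΛ : ∀ ρ, IsState ρ → IsState (Λ ρ)) : BddAbove (increments C Λ) := by
  refine ⟨Fintype.card n * (1 / Real.log 2) + Fintype.card m * (1 / Real.log 2), ?_⟩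
  rintro x ⟨ρ, hρ, rfl⟩
  have h1 := (abs_le.1 (C.abs_eval_le hρ)).1
  have h2 := (abs_le.1 (C.abs_eval_le (hΛ ρ hρ))).2
  linarith

section Channel

variable {k m n : Type*} [Fintype k] [Fintype m] [Fintype n]
  {Λ : Matrix m m ℂ →ₗ[ℂ] Matrix n n ℂ}

/-- Complete positivity, with an arbitrary finite index type for the ancilla. -/
theorem IsChannel.posSemidef_idTensor (hΛ : IsChannel Λ) {X : Matrix (k × m) (k × m) ℂ}
    (hX : X.PosSemidef) : (idTensor k Λ X).PosSemidef := by
  let e := Fintype.equivFin k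
  have h := hΛ.completelyPositive (Fintype.card k)
    (X.submatrix (Prod.map e.symm id) (Prod.map e.symm id)) (hX.submatrix _)
  have h2 := h.submatrix (Prod.map e id)
  convert h2 using 1
  ext a b
  simp [idTensor]

theorem IsChannel.posSemidef_tensorId (hΛ : IsChannel Λ) {X : Matrix (m × k) (m × k) ℂ}
    (hX : X.PosSemidef) : (tensorId Λ k X).PosSemidef :=
  (hΛ.posSemidef_idTensor (hX.submatrix (Prod.swap : k × m → m × k))).submatrix
    (Prod.swap : n × k → k × n)

theorem IsChannel.trace_idTensor (hΛ : IsChannel Λ) (X : Matrix (k × m) (k × m) ℂ) :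
    (idTensor k Λ X).trace = X.trace := by
  simp only [trace, Fintype.sum_prod_type]
  exact Finset.sum_congr rfl fun a _ =>
    hΛ.tracePreserving (Matrix.of fun i j => X (a, i) (a, j))

theorem IsChannel.trace_tensorId (hΛ : IsChannel Λ) (X : Matrix (m × k) (m × k) ℂ) :
    (tensorId Λ k X).trace = X.trace := by
  simp only [trace, Fintype.sum_prod_type_right]
  exact Finset.sum_congr rfl fun a _ =>
    hΛ.tracePreserving (Matrix.of fun i j => X (i, a) (j, a))

theorem IsChannel.isState_map (hΛ : IsChannel Λ) {ρ : Matrix m m ℂ} (h : IsState ρ) :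
    IsState (Λ ρ) := by
  refine ⟨?_, (hΛ.tracePreserving ρ).trans h.2⟩
  exact (hΛ.posSemidef_idTensor (k := Unit) (h.1.submatrix Prod.snd)).submatrix
    fun i => ((), i)

theorem IsChannel.isState_tensor {m' n' : Type*} [Fintype m'] [Fintype n']
    {𝓔 : Matrix m' m' ℂ →ₗ[ℂ] Matrix n' n' ℂ} (hΛ : IsChannel Λ) (h𝓔 : IsChannel 𝓔)
    {ρ : Matrix (m × m') (m × m') ℂ} (h : IsState ρ) : IsState (tensor Λ 𝓔 ρ) :=
  ⟨hΛ.posSemidef_tensorId (h𝓔.posSemidef_idTensor h.1),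
    ((hΛ.trace_tensorId _).trans (h𝓔.trace_idTensor ρ)).trans h.2⟩

end Channel

end

end Coherence

open scoped Pointwise in
theorem theorem4 {m₁ n₁ m₂ n₂ : Type*}
    [Fintype m₁] [DecidableEq m₁] [Nonempty m₁] [Fintype n₁] [DecidableEq n₁]
    [Fintype m₂] [DecidableEq m₂] [Nonempty m₂] [Fintype n₂] [DecidableEq n₂]
    (Λ : Matrix m₁ m₁ ℂ →ₗ[ℂ] Matrix n₁ n₁ ℂ) (hΛ : Coherence.IsChannel Λ)
    (𝓔 : Matrix m₂ m₂ ℂ →ₗ[ℂ] Matrix n₂ n₂ ℂ) (h𝓔 : Coherence.IsChannel 𝓔)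
    (C : Coherence.CoherenceMeasure) :
    (BddAbove (Coherence.increments C Λ) ∧ BddAbove (Coherence.increments C 𝓔) ∧
      BddAbove (Coherence.increments C (Coherence.tensor Λ 𝓔))) ∧
    Coherence.increasingPower C (Coherence.tensor Λ 𝓔) ≥
      Coherence.increasingPower C Λ + Coherence.increasingPower C 𝓔 := by
  have b1 := Coherence.bddAbove_increments C fun ρ => hΛ.isState_map
  have b2 := Coherence.bddAbove_increments C fun ρ => h𝓔.isState_map
  have b3 := Coherence.bddAbove_increments C fun ρ => hΛ.isState_tensor h𝓔
  refine ⟨⟨b1, b2, b3⟩, ?_⟩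
  obtain ⟨ρ₀, hρ₀⟩ := Coherence.exists_isState m₁
  obtain ⟨σ₀, hσ₀⟩ := Coherence.exists_isState m₂
  have ne1 : (Coherence.increments C Λ).Nonempty := ⟨_, ρ₀, hρ₀, rfl⟩
  have ne2 : (Coherence.increments C 𝓔).Nonempty := ⟨_, σ₀, hσ₀, rfl⟩
  rw [ge_iff_le, Coherence.increasingPower, Coherence.increasingPower, ← csSup_add ne1 b1 ne2 b2]
  refine csSup_le_csSup b3 (ne1.add ne2) ?_
  rintro _ ⟨_, ⟨ρ, hρ, rfl⟩, _, ⟨σ, hσ, rfl⟩, rfl⟩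
  refine ⟨_, hρ.kronecker hσ, ?_⟩
  simp only [Coherence.tensor_kronecker, C.eval_kronecker hρ hσ,
    C.eval_kronecker (hΛ.isState_map hρ) (h𝓔.isState_map hσ)]
  ring
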